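/- Let $\Omega_N$ be either the set of perfect matchings of the complete graph $K_N$ ($N$ even) or the set of perfect matchings of the complete bipartite graph $K_{N,N}$, with the uniform probability. Put $p_{N,i}=\frac{1}{(N-1)(N-3)\cdots(N-2i+1)}$ in the case of $K_N$ and $p_{N,i}=\frac{1}{N(N-1)\cdots(N-i+1)}$ in the case of $K_{N,N}$. Matchings are regarded as sets of edges. For a matching $M$ let $A_M=\{F\in\Omega_N : M\subseteq F\}$; two matchings are in conflict if their union is not a matching. Let $\mathcal M$ be a collection of nonempty (not necessarily perfect) matchings of the graph. Let $\mathcal M_i=\{M\in\mathcal M:|M|=i\}$, $I=\{i:\mathcal M_i\neq\emptyset\}$, $r=\max_{M\in\mathcal M}|M|$ and $\mu=\sum_{M\in\mathcal M}\Pr(A_M)$. The collection is called regular if for every $i$ there is an integer $d_i$ such that every vertex is covered by exactly $d_i$ members of $\mathcal M_i$. For $F\in\mathcal M$ let $\mathcal M_F$ be the set $\{M\setminus F : M\in\mathcal M,\ M\ne F,\ M\cap F\neq\emptyset,\ M \text{ and } F \text{ not in conflict}\}$. A regular collection is called $\delta$-sparse if 1. no member of $\mathcal M$ is a proper subset of another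 member; 2. $\sum_{j\in I} d_j\,p_{N-2r+2,j}<\frac1{8r}-\delta$; 3. $\sum_{M\in\mathcal M_F}p_{N,|M|}\le\delta$ for every $F\in\mathcal M$; 4. $16r\delta<1$. **Theorem.** Consider a sequence of regular collections $\mathcal M=\mathcal M^{(n)}$ of nonempty matchings of $K_N$ (with $N=N(n)$ even for all $n$), or a sequence of regular collections of nonempty matchings of $K_{N,N}$ (with $N=N(n)$), with associated parameters $r=r(n)$ and $\mu=\mu(n)$. Suppose that, as $n\to\infty$, $\mu=o(\sqrt N\,r^{-3/2})$, that $\mu\ge c$ for some constant $c>0$ and all $n$, and that each $\mathcal M^{(n)}$ is $\delta$-sparse for some $\delta=\delta(n)$ with $\delta=o(\mu^{-1})$. Then, as $n\to\infty$, $$\Pr\Bigl(\bigwedge_{M\in\mathcal M}\overline{A_M}\Bigr)=(1+o(1))\,e^{-\mu}.$$ -/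

import Mathlib

open Filter Asymptotics Finset

namespace MatchingSieve

variable {V : Type*} [Fintype V] [DecidableEq V]

/-- A (partial) matching of `G`, given by its edge set: a finite set of edges of `G`, any two
distinct ones of which have no common endpoint. -/
def IsMatching (G : SimpleGraph V) (M : Finset (Sym2 V)) : Prop :=
  (∀ e ∈ M, e ∈ G.edgeSet) ∧ ∀ e ∈ M, ∀ f ∈ M, ∀ v : V, v ∈ e → v ∈ f → e = f

/-- The vertex `v` is covered by some edge of `M`, that is, `v ∈ V(M)`. -/
def Covers (M : Finset (Sym2 V)) (v : V) : Prop := ∃ e ∈ M, v ∈ e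

/-- Two matchings are in conflict if their union is not a matching. -/
def Conflict (G : SimpleGraph V) (M₁ M₂ : Finset (Sym2 V)) : Prop :=
  ¬ IsMatching G (M₁ ∪ M₂)

open Classical in
/-- The sample space: the set of all perfect matchings of `G`. -/
noncomputable def perfectMatchings (G : SimpleGraph V) : Finset (Finset (Sym2 V)) :=
  {F | IsMatching G F ∧ ∀ v, Covers F v}

open Classical in
/-- The probability that a uniformly random perfect matching of `G` has the property `P`. -/
noncomputable def prob (G : SimpleGraph V) (P : Finset (Sym2 V) → Prop) : ℝ :=
  (#{F ∈ perfectMatchings G | P F} : ℝ) / (#(perfectMatchings G) : ℝ)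

/-- `μ = ∑_{M ∈ 𝓜} Pr(A_M)`, where `A_M` is the event that the random perfect matching
contains `M`. -/
noncomputable def mu (G : SimpleGraph V) (𝓜 : Finset (Finset (Sym2 V))) : ℝ :=
  ∑ M ∈ 𝓜, prob G (fun F => M ⊆ F)

/-- The probability that none of the events `A_M`, `M ∈ 𝓜`, occurs. -/
noncomputable def probNone (G : SimpleGraph V) (𝓜 : Finset (Finset (Sym2 V))) : ℝ :=
  prob G (fun F => ∀ M ∈ 𝓜, ¬ M ⊆ F)

/-- A collection of matchings of `G`; as all the events `A_M` are to be canonical,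
the matchings are nonempty. -/
def IsCollection (G : SimpleGraph V) (𝓜 : Finset (Finset (Sym2 V))) : Prop :=
  ∀ M ∈ 𝓜, IsMatching G M ∧ M.Nonempty

/-- The maximum size `r` of the members of the collection. -/
def maxSize (𝓜 : Finset (Finset (Sym2 V))) : ℕ := 𝓜.sup card

open Classical in
/-- The number of matchings of size `i` in the collection that cover the vertex `v`. -/
noncomputable def degree (𝓜 : Finset (Finset (Sym2 V))) (i : ℕ) (v : V) : ℕ :=
  #{M ∈ 𝓜 | #M = i ∧ Covers M v}

/-- The maximum over all vertices of the degree with respect to the matchings of size `i`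
(for a regular collection, the common degree). -/
noncomputable def maxDegree (𝓜 : Finset (Finset (Sym2 V))) (i : ℕ) : ℕ :=
  univ.sup (degree 𝓜 i)

/-- For each size `i`, every vertex is covered by the same number of matchings of size `i`. -/
def IsRegular (𝓜 : Finset (Finset (Sym2 V))) : Prop :=
  ∀ i : ℕ, ∃ d : ℕ, ∀ v : V, degree 𝓜 i v = d

open Classical in
/-- The set `𝓜_F` of all `M \ F` with `M ∈ 𝓜`, `M ≠ F`, `M ∩ F ≠ ∅`, and `M`, `F` not in
conflict. It is a set: coinciding differences are counted once. -/
noncomputable def residual (G : SimpleGraph V) (𝓜 : Finset (Finset (Sym2 V)))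
    (F : Finset (Sym2 V)) : Finset (Finset (Sym2 V)) :=
  {M ∈ 𝓜 | M ≠ F ∧ (M ∩ F).Nonempty ∧ ¬ Conflict G F M}.image (fun M => M \ F)

/-- `δ`-sparseness of a collection of matchings of the graph `G` of order parameter `N`, where
`p N i` is the formula for the probability that a fixed matching of size `i` is extended. -/
structure IsSparse (p : ℤ → ℕ → ℝ) (G : SimpleGraph V) (N : ℕ)
    (𝓜 : Finset (Finset (Sym2 V))) (δ : ℝ) : Prop where
  antichain : ∀ M ∈ 𝓜, ∀ M' ∈ 𝓜, M ⊆ M' → M = M'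
  degree_sum : ∑ j ∈ 𝓜.image card,
      (maxDegree 𝓜 j : ℝ) * p ((N : ℤ) - 2 * (maxSize 𝓜 : ℤ) + 2) j
        < 1 / (8 * (maxSize 𝓜 : ℝ)) - δ
  residual_sum : ∀ F ∈ 𝓜, ∑ M ∈ residual G 𝓜 F, p (N : ℤ) (#M) ≤ δ
  small : 16 * (maxSize 𝓜 : ℝ) * δ < 1

/-- `p_{N,i} = 1 / ((N-1)(N-3)⋯(N-2i+1))`, for the complete graph `K_N`. -/
noncomputable def pComplete (N : ℤ) (i : ℕ) : ℝ :=
  1 / ∏ l ∈ range i, ((N : ℝ) - 2 * (l : ℝ) - 1)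

/-- `p_{N,i} = 1 / (N(N-1)⋯(N-i+1))`, for the complete bipartite graph `K_{N,N}`. -/
noncomputable def pBipartite (N : ℤ) (i : ℕ) : ℝ :=
  1 / ∏ l ∈ range i, ((N : ℝ) - (l : ℝ))

/-- The complete graph `K_N`. -/
abbrev K (N : ℕ) : SimpleGraph (Fin N) := ⊤

/-- The complete bipartite graph `K_{N,N}`. -/
abbrev KK (N : ℕ) : SimpleGraph (Fin N ⊕ Fin N) := completeBipartiteGraph (Fin N) (Fin N)

end MatchingSieve

/-!
The proof compares, for a matching `L` and a family `S` of matchings, the numbers `extCount G L S`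
of perfect matchings that contain `L` and avoid `S`. The only properties of `K_N` and `K_{N,N}` in
use (`IsSwapRegular`) are that exchanging two neighbours `v`, `w` of a vertex `u` is an
automorphism, and that once a matching of size `k` is removed, each remaining vertex has `D - s * k`
remaining neighbours.

Exchanging `v` and `w` turns perfect matchings through `uv` into perfect matchings through `uw`
without creating a member of `S`, provided `S` does not cover `u` or `v`. Hence prescribing `M` does
not make it easier to avoid matchings that are vertex-disjoint from `M`
(`IsSwapRegular.chain_mul_extCount_le`), which is the hypothesis of the lopsided local lemma. The
local lemma (`IsThin.extCount_union_le`) bounds the probability of `M ⊆ F` conditional on avoiding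
`S` by `(1 + o(1))` times its unconditional probability, and multiplying over the collection gives
the lower bound (`IsThin.exp_mul_le_extCount`).

For the upper bound the same exchange is read backwards. It fails to avoid `S` only if it creates a
member covering `w`, and by the local lemma this is rare, so that prescribing `M` hardly makes it
harder to avoid matchings vertex-disjoint from `M` (`IsThin.extCount_le_chain_mul`). Members in
conflict with `M` are avoided for free, and those that share an edge with `M` are controlled through
the residual collection and the parameter `δ` (`IsThin.mul_extCount_le`). So each `M` has
probability at least `(1 - ε)` times its own, conditional on avoiding any other members, and the
chain rule gives `exp (-(1 - ε) * μ)` (`IsThin.extCount_le_exp_mul`).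

Regularity spreads the total weight `μ` evenly over the vertices, so that the members covering a
given vertex have total weight at most `2 * r * μ / N` (`IsRegular.sum_covers_le`). All errors in the
exponent are then `O(r ^ 2 * μ ^ 2 / N + δ * μ)`, which tends to `0` (`isEquivalent_probNone`).
-/

set_option linter.unusedSectionVars false

namespace MatchingSieve

section

variable {V : Type*} [Fintype V] [DecidableEq V] {G : SimpleGraph V}

/-! ### Partial matchings and vertex swaps -/

open Classical in
/-- The set of neighbours of `u` that are not covered by `L`. -/
noncomputable def free (G : SimpleGraph V) (L : Finset (Sym2 V)) (u : V) : Finset V :=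
  {v | G.Adj u v ∧ ¬ Covers L v}

open Classical in
/-- The properties of `K_N` and `K_{N,N}` on which the argument rests: two neighbours of a vertex
are twins, so that exchanging them is an automorphism; `G` is `D`-regular; and each vertex off an
edge is adjacent to exactly `s` of the two ends of the edge. -/
structure IsSwapRegular (G : SimpleGraph V) (D s : ℕ) : Prop where
  adj_swap : ∀ u v w x y, G.Adj u v → G.Adj u w → G.Adj x y →
    G.Adj (Equiv.swap v w x) (Equiv.swap v w y)
  card_adj : ∀ u, #{v | G.Adj u v} = D
  card_adj_pair : ∀ u a b, G.Adj a b → u ≠ a → u ≠ b →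
    #{v ∈ ({a, b} : Finset V) | G.Adj u v} = s

@[simp] lemma mem_free {L : Finset (Sym2 V)} {u v : V} :
    v ∈ free G L u ↔ G.Adj u v ∧ ¬ Covers L v := by simp [free]

lemma covers_insert {L : Finset (Sym2 V)} {e : Sym2 V} {v : V} :
    Covers (insert e L) v ↔ v ∈ e ∨ Covers L v := by
  simp [Covers]

lemma covers_union {L M : Finset (Sym2 V)} {v : V} :
    Covers (L ∪ M) v ↔ Covers L v ∨ Covers M v := by
  simp [Covers, or_and_right, exists_or]

lemma not_covers_empty {v : V} : ¬ Covers (∅ : Finset (Sym2 V)) v := by simp [Covers]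

lemma Covers.mono {L M : Finset (Sym2 V)} {v : V} (h : Covers L v) (hLM : L ⊆ M) : Covers M v := by
  obtain ⟨e, he, hv⟩ := h
  exact ⟨e, hLM he, hv⟩

lemma IsMatching.subset {L M : Finset (Sym2 V)} (hM : IsMatching G M) (h : L ⊆ M) :
    IsMatching G L :=
  ⟨fun e he => hM.1 e (h he), fun e he f hf => hM.2 e (h he) f (h hf)⟩

lemma isMatching_empty : IsMatching G ∅ := by simp [IsMatching]

/-- An edge of a matching does not meet the vertices covered by the other edges. -/
lemma IsMatching.not_covers {L : Finset (Sym2 V)} {e : Sym2 V} (h : IsMatching G (insert e L))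
    (he : e ∉ L) {v : V} (hv : v ∈ e) : ¬ Covers L v := by
  rintro ⟨f, hf, hvf⟩
  have := h.2 e (by simp) f (by simp [hf]) v hv hvf
  exact he (this ▸ hf)

lemma IsMatching.insert {L : Finset (Sym2 V)} {u v : V} (h : IsMatching G L) (huv : G.Adj u v)
    (hu : ¬ Covers L u) (hv : ¬ Covers L v) : IsMatching G (insert s(u, v) L) := by
  have key : ∀ e ∈ L, ∀ x ∈ s(u, v), x ∉ e := by
    intro e he x hx hxe
    rcases Sym2.mem_iff.1 hx with rfl | rfl
    · exact hu ⟨e, he, hxe⟩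
    · exact hv ⟨e, he, hxe⟩
  refine ⟨?_, ?_⟩
  · intro e he
    rcases mem_insert.1 he with rfl | he
    · exact huv
    · exact h.1 e he
  · intro e he f hf x hxe hxf
    rcases mem_insert.1 he with rfl | he <;> rcases mem_insert.1 hf with rfl | hf
    · rfl
    · exact (key f hf x hxe hxf).elim
    · exact (key e he x hxf hxe).elim
    · exact h.2 e he f hf x hxe hxf

/-- Vertex-disjoint matchings unite to a matching. -/
lemma IsMatching.union {L M : Finset (Sym2 V)} (hL : IsMatching G L) (hM : IsMatching G M)
    (h : ∀ v, Covers L v → ¬ Covers M v) : IsMatching G (L ∪ M) := by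
  refine ⟨?_, ?_⟩
  · intro e he
    rcases mem_union.1 he with he | he
    · exact hL.1 e he
    · exact hM.1 e he
  · intro e he f hf x hxe hxf
    rcases mem_union.1 he with he | he <;> rcases mem_union.1 hf with hf | hf
    · exact hL.2 e he f hf x hxe hxf
    · exact (h x ⟨e, he, hxe⟩ ⟨f, hf, hxf⟩).elim
    · exact (h x ⟨f, hf, hxf⟩ ⟨e, he, hxe⟩).elim
    · exact hM.2 e he f hf x hxe hxf

/-- After a matching of size `k` has been removed, every remaining vertex has `D - s * k`
remaining neighbours. -/
lemma IsSwapRegular.card_free {D s : ℕ} (hG : IsSwapRegular G D s) {L : Finset (Sym2 V)}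
    (hL : IsMatching G L) {u : V} (hu : ¬ Covers L u) : #(free G L u) + s * #L = D := by
  classical
  induction L using Finset.induction_on with
  | empty =>
    rw [← hG.card_adj u]
    simp [free, not_covers_empty]
  | @insert e L he ih =>
    have ih' := ih (hL.subset (subset_insert _ _)) (fun h => hu (h.mono (subset_insert _ _)))
    induction e using Sym2.ind with | _ a b => ?_
    have hab : G.Adj a b := hL.1 s(a, b) (by simp)
    have ha := hL.not_covers he (v := a) (by simp)
    have hb := hL.not_covers he (v := b) (by simp)
    have hua : u ≠ a := by rintro rfl; exact hu (covers_insert.2 (by simp))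
    have hub : u ≠ b := by rintro rfl; exact hu (covers_insert.2 (by simp))
    have hsplit : free G L u = free G (insert s(a, b) L) u ∪
        {v ∈ ({a, b} : Finset V) | G.Adj u v} := by
      ext x
      simp only [mem_free, covers_insert, mem_union, mem_filter, Sym2.mem_iff, mem_insert,
        mem_singleton]
      constructor
      · tauto
      · rintro (h | ⟨rfl | rfl, h⟩) <;> tauto
    have hd : Disjoint (free G (insert s(a, b) L) u) {v ∈ ({a, b} : Finset V) | G.Adj u v} := by
      rw [Finset.disjoint_left]
      intro x hx hx'
      simp only [mem_free, covers_insert, mem_filter, Sym2.mem_iff, mem_insert,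
        mem_singleton] at hx hx'
      tauto
    rw [hsplit, card_union_of_disjoint hd, hG.card_adj_pair u a b hab hua hub] at ih'
    rw [card_insert_of_notMem he, ← ih']
    ring

/-- The matching `F` with the vertices `v` and `w` exchanged. -/
def swapEdges (v w : V) (F : Finset (Sym2 V)) : Finset (Sym2 V) :=
  F.image (Sym2.map (Equiv.swap v w))

lemma map_swap_map_swap (v w : V) (e : Sym2 V) :
    Sym2.map (Equiv.swap v w) (Sym2.map (Equiv.swap v w) e) = e := by
  induction e using Sym2.ind with | _ a b => ?_
  simp

lemma mem_swapEdges {v w : V} {F : Finset (Sym2 V)} {e : Sym2 V} :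
    e ∈ swapEdges v w F ↔ Sym2.map (Equiv.swap v w) e ∈ F := by
  unfold swapEdges
  rw [mem_image]
  constructor
  · rintro ⟨f, hf, rfl⟩
    rwa [map_swap_map_swap]
  · intro h
    exact ⟨_, h, map_swap_map_swap v w e⟩

lemma swapEdges_swapEdges (v w : V) (F : Finset (Sym2 V)) :
    swapEdges v w (swapEdges v w F) = F := by
  ext e
  rw [mem_swapEdges, mem_swapEdges, map_swap_map_swap]

lemma map_swap_of_notMem {v w : V} {e : Sym2 V} (hv : v ∉ e) (hw : w ∉ e) :
    Sym2.map (Equiv.swap v w) e = e := by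
  induction e using Sym2.ind with | _ a b => ?_
  simp only [Sym2.mem_iff, not_or] at hv hw
  rw [Sym2.map_mk, Equiv.swap_apply_of_ne_of_ne (Ne.symm hv.1) (Ne.symm hw.1),
    Equiv.swap_apply_of_ne_of_ne (Ne.symm hv.2) (Ne.symm hw.2)]

lemma mem_map_swap {v w x : V} {e : Sym2 V} :
    x ∈ Sym2.map (Equiv.swap v w) e ↔ Equiv.swap v w x ∈ e := by
  rw [Sym2.mem_map]
  constructor
  · rintro ⟨y, hy, rfl⟩
    simpa using hy
  · intro h
    exact ⟨_, h, by simp⟩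

lemma mem_perfectMatchings {F : Finset (Sym2 V)} :
    F ∈ perfectMatchings G ↔ IsMatching G F ∧ ∀ v, Covers F v := by
  simp [perfectMatchings]

lemma IsSwapRegular.swapEdges_mem {D s : ℕ} (hG : IsSwapRegular G D s) {u v w : V}
    (hv : G.Adj u v) (hw : G.Adj u w) {F : Finset (Sym2 V)} (hF : F ∈ perfectMatchings G) :
    swapEdges v w F ∈ perfectMatchings G := by
  rw [mem_perfectMatchings] at hF ⊢
  obtain ⟨⟨h1, h2⟩, h3⟩ := hF
  refine ⟨⟨?_, ?_⟩, ?_⟩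
  · intro e he
    rw [mem_swapEdges] at he
    have := h1 _ he
    induction e using Sym2.ind with | _ a b => ?_
    have := hG.adj_swap u v w _ _ hv hw this
    simpa using this
  · intro e he f hf x hxe hxf
    rw [mem_swapEdges] at he hf
    have := h2 _ he _ hf (Equiv.swap v w x) (by simpa [mem_map_swap] using hxe)
      (by simpa [mem_map_swap] using hxf)
    rw [← map_swap_map_swap v w e, this, map_swap_map_swap]
  · intro x
    obtain ⟨e, he, hx⟩ := h3 (Equiv.swap v w x)
    exact ⟨_, mem_swapEdges.2 (by rwa [map_swap_map_swap]), mem_map_swap.2 hx⟩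

/-! ### Counting perfect matchings that extend `L` and avoid `S` -/

open Classical in
/-- The number of perfect matchings that contain `L` and contain no member of `S`. -/
noncomputable def extCount (G : SimpleGraph V) (L : Finset (Sym2 V))
    (S : Finset (Finset (Sym2 V))) : ℝ :=
  #{F ∈ perfectMatchings G | L ⊆ F ∧ ∀ M ∈ S, ¬ M ⊆ F}

lemma extCount_nonneg (L : Finset (Sym2 V)) (S : Finset (Finset (Sym2 V))) :
    0 ≤ extCount G L S := Nat.cast_nonneg _

lemma extCount_anti (L : Finset (Sym2 V)) {S T : Finset (Finset (Sym2 V))} (h : T ⊆ S) :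
    extCount G L S ≤ extCount G L T := by
  unfold extCount
  gcongr

/-- Union bound: if every matching that extends `L`, avoids `T` and fails to avoid `S` contains a
member of `R`, then at most `∑ M ∈ R, extCount G (L ∪ M) T` of them are lost when passing from
`T` to `S`. -/
lemma extCount_le_add_sum (L : Finset (Sym2 V)) (S T R : Finset (Finset (Sym2 V)))
    (h : ∀ F ∈ perfectMatchings G, L ⊆ F → ∀ M ∈ S, M ∉ T → M ⊆ F → ∃ M' ∈ R, M' ⊆ F) :
    extCount G L T ≤ extCount G L S + ∑ M ∈ R, extCount G (L ∪ M) T := by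
  classical
  unfold extCount
  rw [← Nat.cast_sum, ← Nat.cast_add, Nat.cast_le]
  refine le_trans (card_le_card (t := {F ∈ perfectMatchings G | L ⊆ F ∧ ∀ M ∈ S, ¬ M ⊆ F} ∪
    R.biUnion fun M' => {F ∈ perfectMatchings G | L ∪ M' ⊆ F ∧ ∀ M ∈ T, ¬ M ⊆ F}) ?_) ?_
  · intro F hF
    simp only [mem_filter, mem_union, mem_biUnion] at hF ⊢
    obtain ⟨hF, hL, hT⟩ := hF
    by_cases hS : ∀ M ∈ S, ¬ M ⊆ F
    · exact Or.inl ⟨hF, hL, hS⟩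
    · push Not at hS
      obtain ⟨M, hM, hMF⟩ := hS
      obtain ⟨M', hM', hMF'⟩ := h F hF hL M hM (fun hMT => hT M hMT hMF) hMF
      exact Or.inr ⟨M', hM', hF, union_subset hL hMF', hT⟩
  · exact (card_union_le _ _).trans (Nat.add_le_add_left card_biUnion_le _)

lemma extCount_le_add_sum_sdiff (L : Finset (Sym2 V)) (S T : Finset (Finset (Sym2 V))) :
    extCount G L T ≤ extCount G L S + ∑ M ∈ S \ T, extCount G (L ∪ M) T :=
  extCount_le_add_sum L S T _ fun _ _ _ M hM hMT hMF => ⟨M, mem_sdiff.2 ⟨hM, hMT⟩, hMF⟩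

/-- Adding a member to the family to be avoided removes exactly the extensions containing it. -/
lemma extCount_empty_insert (M : Finset (Sym2 V)) (S : Finset (Finset (Sym2 V))) :
    extCount G ∅ (insert M S) = extCount G ∅ S - extCount G M S := by
  classical
  rw [eq_sub_iff_add_eq]
  unfold extCount
  rw [← Nat.cast_add, Nat.cast_inj, ← card_filter_add_card_filter_not
    (s := {F ∈ perfectMatchings G | ∅ ⊆ F ∧ ∀ M ∈ S, ¬ M ⊆ F}) (fun F => ¬ M ⊆ F)]
  congr 2 <;> (ext F; simp only [mem_filter, forall_mem_insert, not_not, empty_subset]; tauto)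

/-- Classification of the extensions of `L` by the partner of an uncovered vertex `u`. -/
lemma extCount_eq_sum {L : Finset (Sym2 V)} (S : Finset (Finset (Sym2 V))) {u : V}
    (hu : ¬ Covers L u) :
    extCount G L S = ∑ w ∈ free G L u, extCount G (insert s(u, w) L) S := by
  classical
  unfold extCount
  rw [← Nat.cast_sum, Nat.cast_inj, ← card_biUnion]
  · congr 1
    ext F
    simp only [mem_filter, mem_biUnion, mem_free, insert_subset_iff]
    constructor
    · rintro ⟨hF, hL, hS⟩
      obtain ⟨hm, hc⟩ := mem_perfectMatchings.1 hF
      obtain ⟨e, he, hue⟩ := hc u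
      obtain ⟨w, rfl⟩ := hue
      refine ⟨w, ⟨hm.1 _ he, ?_⟩, hF, ⟨he, hL⟩, hS⟩
      rintro ⟨f, hf, hwf⟩
      have := hm.2 _ he f (hL hf) w (by simp) hwf
      exact hu ⟨f, hf, by simp [← this]⟩
    · rintro ⟨w, -, hF, ⟨-, hL⟩, hS⟩
      exact ⟨hF, hL, hS⟩
  · intro w _ w' _ hne
    rw [Function.onFun, Finset.disjoint_left]
    intro F hF hF'
    simp only [mem_filter, insert_subset_iff] at hF hF'
    have := (mem_perfectMatchings.1 hF.1).1.2 _ hF.2.1.1 _ hF'.2.1.1 u (by simp) (by simp)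
    exact hne (Sym2.congr_right.1 this)

/-- Exchanging `v` and `w` turns matchings through `uv` into matchings through `uw`; it creates
no member of `S` if no member of `S` covers `u` or `v`, since `w` is then matched to `u`. -/
lemma IsSwapRegular.extCount_insert_le {D s : ℕ} (hG : IsSwapRegular G D s)
    {L : Finset (Sym2 V)} {S : Finset (Finset (Sym2 V))} {u v w : V}
    (hv : v ∈ free G L u) (hw : w ∈ free G L u)
    (hSu : ∀ M ∈ S, ¬ Covers M u) (hSv : ∀ M ∈ S, ¬ Covers M v) :
    extCount G (insert s(u, v) L) S ≤ extCount G (insert s(u, w) L) S := by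
  classical
  rw [mem_free] at hv hw
  unfold extCount
  rw [Nat.cast_le]
  refine card_le_card_of_injOn (swapEdges v w) ?_
    (fun F _ F' _ h => by rw [← swapEdges_swapEdges v w F, h, swapEdges_swapEdges])
  intro F hF
  simp only [coe_filter, Set.mem_ofPred_eq, insert_subset_iff] at hF ⊢
  obtain ⟨hF, ⟨huv, hL⟩, hS⟩ := hF
  have hF' := hG.swapEdges_mem hv.1 hw.1 hF
  have huw : s(u, w) ∈ swapEdges v w F := by
    rw [mem_swapEdges, Sym2.map_mk, Equiv.swap_apply_right,
      Equiv.swap_apply_of_ne_of_ne hv.1.ne hw.1.ne]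
    exact huv
  refine ⟨hF', ⟨huw, ?_⟩, ?_⟩
  · intro e he
    rw [mem_swapEdges, map_swap_of_notMem (fun h => hv.2 ⟨e, he, h⟩) (fun h => hw.2 ⟨e, he, h⟩)]
    exact hL he
  · intro M hM hMF
    refine hS M hM fun e he => ?_
    have hwe : w ∉ e := by
      intro h
      have := (mem_perfectMatchings.1 hF').1.2 _ huw e (hMF he) w (by simp) h
      exact hSu M hM ⟨e, he, by simp [← this]⟩
    have := hMF he
    rwa [mem_swapEdges, map_swap_of_notMem (fun h => hSv M hM ⟨e, he, h⟩) hwe] at this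

/-- The number `D - s * k` of choices for the partner of a vertex once a matching of size `k`
has been removed, as a real number. -/
def choices (D s k : ℕ) : ℝ := (D : ℝ) - s * k

lemma IsSwapRegular.card_free_real {D s : ℕ} (hG : IsSwapRegular G D s) {L : Finset (Sym2 V)}
    (hL : IsMatching G L) {u : V} (hu : ¬ Covers L u) :
    (#(free G L u) : ℝ) = choices D s #L := by
  have := hG.card_free hL hu
  rw [choices, ← this]
  push_cast
  ring

/-- Negative dependence, one edge at a time. -/
lemma IsSwapRegular.choices_mul_extCount_le {D s : ℕ} (hG : IsSwapRegular G D s)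
    {L : Finset (Sym2 V)} {S : Finset (Finset (Sym2 V))} {u v : V} (hL : IsMatching G L)
    (hu : ¬ Covers L u) (hv : v ∈ free G L u)
    (hSu : ∀ M ∈ S, ¬ Covers M u) (hSv : ∀ M ∈ S, ¬ Covers M v) :
    choices D s #L * extCount G (insert s(u, v) L) S ≤ extCount G L S := by
  rw [extCount_eq_sum S hu, ← hG.card_free_real hL hu, ← nsmul_eq_mul]
  exact card_nsmul_le_sum _ _ _ fun w hw => hG.extCount_insert_le hv hw hSu hSv

/-- The vertices covered by `L` and by `M` are disjoint. -/
def VertexDisjoint (L M : Finset (Sym2 V)) : Prop := ∀ v, Covers L v → ¬ Covers M v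

/-- The factor `∏ l < j, (D - s * (k + l))` by which the number of perfect matchings drops when a
matching of size `k` is extended to a prescribed one of size `k + j`. -/
def chain (D s k j : ℕ) : ℝ := ∏ l ∈ range j, choices D s (k + l)

/-- Negative dependence: prescribing a matching `M` that is vertex-disjoint from all members of
`S` does not make it easier to avoid `S`. -/
lemma IsSwapRegular.chain_mul_extCount_le {D s : ℕ} (hG : IsSwapRegular G D s)
    {L M : Finset (Sym2 V)} {S : Finset (Finset (Sym2 V))} (hL : IsMatching G L)
    (hM : IsMatching G M) (hLM : VertexDisjoint L M) (hS : ∀ T ∈ S, VertexDisjoint M T)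
    (hpos : ∀ l < #L + #M, 0 ≤ choices D s l) :
    chain D s #L #M * extCount G (L ∪ M) S ≤ extCount G L S := by
  induction M using Finset.induction_on with
  | empty => simp [chain]
  | @insert e M he ih =>
    have hM' : IsMatching G M := hM.subset (subset_insert _ _)
    have hLM' : VertexDisjoint L M := fun x hx h => hLM x hx (h.mono (subset_insert _ _))
    rw [card_insert_of_notMem he] at hpos ⊢
    have ih' := ih hM' hLM' (fun T hT x hx => hS T hT x (hx.mono (subset_insert _ _)))
      (fun l hl => hpos l (by omega))
    have hd : Disjoint L M := by
      rw [Finset.disjoint_left]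
      intro f hf hf'
      induction f using Sym2.ind with | _ a b => ?_
      exact hLM' a ⟨_, hf, by simp⟩ ⟨_, hf', by simp⟩
    induction e using Sym2.ind with | _ a b => ?_
    have hcov : ∀ x ∈ s(a, b), Covers (insert s(a, b) M) x := fun x hx => ⟨_, by simp, hx⟩
    have hnot : ∀ x ∈ s(a, b), ¬ Covers (L ∪ M) x := by
      intro x hx h
      rcases covers_union.1 h with h | h
      · exact hLM x h (hcov x hx)
      · exact hM.not_covers he hx h
    have hab : G.Adj a b := hM.1 s(a, b) (by simp)
    have step := hG.choices_mul_extCount_le (S := S) (hL.union hM' hLM') (hnot a (by simp))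
      (mem_free.2 ⟨hab, hnot b (by simp)⟩) (fun T hT => hS T hT a (hcov a (by simp)))
      (fun T hT => hS T hT b (hcov b (by simp)))
    rw [card_union_of_disjoint hd] at step
    rw [union_insert, chain, prod_range_succ, ← chain]
    have hc : 0 ≤ chain D s #L #M := prod_nonneg fun l hl => hpos _ (by
      have := mem_range.1 hl; omega)
    calc _ = chain D s #L #M * (choices D s (#L + #M) * extCount G (insert s(a, b) (L ∪ M)) S) := by
          ring
      _ ≤ chain D s #L #M * extCount G (L ∪ M) S := by gcongr
      _ ≤ _ := ih'

/-! ### The lopsided local lemma -/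

/-- The finite set of vertices covered by `M`. -/
def support (M : Finset (Sym2 V)) : Finset V := M.biUnion Sym2.toFinset

lemma mem_support {M : Finset (Sym2 V)} {v : V} : v ∈ support M ↔ Covers M v := by
  simp [support, Covers]

lemma card_support_le (M : Finset (Sym2 V)) : #(support M) ≤ 2 * #M := by
  rw [support, mul_comm]
  refine card_biUnion_le_card_mul _ _ _ fun e _ => ?_
  by_cases h : e.IsDiag
  · rw [Sym2.card_toFinset_of_isDiag e h]; norm_num
  · rw [Sym2.card_toFinset_of_not_isDiag e h]

open Classical in
/-- If the weights of the members of `S` at each vertex sum to at most `τ`, then those of the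
members that meet the vertices of `M` sum to at most `2 * #M * τ`. -/
lemma sum_touching_le {S : Finset (Finset (Sym2 V))} {f : Finset (Sym2 V) → ℝ} {τ : ℝ}
    (hf : ∀ T ∈ S, 0 ≤ f T) (hτ : 0 ≤ τ) (h : ∀ v, ∑ T ∈ S with Covers T v, f T ≤ τ)
    (M : Finset (Sym2 V)) :
    ∑ T ∈ S with ¬ VertexDisjoint M T, f T ≤ 2 * #M * τ := by
  calc ∑ T ∈ S with ¬ VertexDisjoint M T, f T
      ≤ ∑ T ∈ S, ∑ v ∈ support M, if Covers T v then f T else 0 := by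
        rw [sum_filter]
        refine sum_le_sum fun T hT => ?_
        have hnn : ∀ v ∈ support M, 0 ≤ if Covers T v then f T else 0 := by
          intro v _
          split_ifs
          exacts [hf T hT, le_rfl]
        by_cases hd : VertexDisjoint M T
        · rw [if_neg (not_not.2 hd)]
          exact sum_nonneg hnn
        · rw [if_pos hd]
          unfold VertexDisjoint at hd
          push Not at hd
          obtain ⟨v, hv, hv'⟩ := hd
          refine le_trans ?_ (single_le_sum hnn (mem_support.2 hv))
          simp [hv']
    _ = ∑ v ∈ support M, ∑ T ∈ S with Covers T v, f T := by
        rw [sum_comm]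
        simp only [sum_filter]
    _ ≤ ∑ v ∈ support M, τ := sum_le_sum fun v _ => h v
    _ ≤ 2 * #M * τ := by
        rw [sum_const, nsmul_eq_mul]
        gcongr
        exact_mod_cast card_support_le M

open Classical in
/-- A family of matchings of size at most `r` such that the probabilities of its members at each
vertex sum to at most `τ`, also after the removal of any matching of size `k ≤ r`, where `τ` is
small enough for the local lemma. The field `choices_pos` keeps all these probabilities
meaningful. -/
structure IsThin (G : SimpleGraph V) (D s r : ℕ) (τ : ℝ) (S : Finset (Finset (Sym2 V))) :
    Prop where
  isMatching : ∀ M ∈ S, IsMatching G M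
  card_le : ∀ M ∈ S, #M ≤ r
  choices_pos : ∀ l < 2 * r, 0 < choices D s l
  nonneg : 0 ≤ τ
  small : 8 * r * τ ≤ 1
  sum_le : ∀ k ≤ r, ∀ v, ∑ M ∈ S with Covers M v, (chain D s k #M)⁻¹ ≤ τ

lemma chain_pos {D s r k j : ℕ} (h : ∀ l < 2 * r, 0 < choices D s l) (hk : k ≤ r) (hj : j ≤ r) :
    0 < chain D s k j :=
  prod_pos fun l hl => h _ (by have := mem_range.1 hl; omega)

open Classical in
lemma IsThin.subset {D s r : ℕ} {τ : ℝ} {S T : Finset (Finset (Sym2 V))}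
    (hS : IsThin G D s r τ S) (h : T ⊆ S) : IsThin G D s r τ T where
  isMatching M hM := hS.isMatching M (h hM)
  card_le M hM := hS.card_le M (h hM)
  choices_pos := hS.choices_pos
  nonneg := hS.nonneg
  small := hS.small
  sum_le k hk v := by
    refine le_trans (sum_le_sum_of_subset_of_nonneg (filter_subset_filter _ h) ?_)
      (hS.sum_le k hk v)
    intro M hM _
    exact inv_nonneg.2 (chain_pos hS.choices_pos hk (hS.card_le M (mem_filter.1 hM).1)).le

/-- If prescribing a member of `S \ T` multiplies the number of matchings that avoid `T` by at
most twice its probability, then avoiding `S \ T` as well costs at most a factor `1 - 2 * β`. -/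
lemma extCount_sdiff_le {D s : ℕ} {L : Finset (Sym2 V)} {S T : Finset (Finset (Sym2 V))} {β : ℝ}
    (h : ∀ M ∈ S \ T, extCount G (L ∪ M) T ≤ 2 * (chain D s #L #M)⁻¹ * extCount G L T)
    (hβ : ∑ M ∈ S \ T, (chain D s #L #M)⁻¹ ≤ β) :
    (1 - 2 * β) * extCount G L T ≤ extCount G L S := by
  have h1 := extCount_le_add_sum_sdiff (G := G) L S T
  have h2 := sum_le_sum h
  rw [← sum_mul, ← mul_sum] at h2
  have h3 := mul_le_mul_of_nonneg_right hβ (extCount_nonneg (G := G) L T)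
  linarith

/-- The lopsided local lemma for matchings: among the perfect matchings that contain `L` and
avoid `S`, those that contain `M` are rarer than their unconditional probability suggests by no
more than the factor `(1 - 4 * r * τ)⁻¹`. -/
lemma IsThin.extCount_union_le {D s r : ℕ} {τ : ℝ} (hG : IsSwapRegular G D s)
    {L : Finset (Sym2 V)} (hL : IsMatching G L) (hLr : #L ≤ r) (S : Finset (Finset (Sym2 V))) :
    IsThin G D s r τ S → (∀ T ∈ S, VertexDisjoint L T) → ∀ M, IsMatching G M → #M ≤ r →
    VertexDisjoint L M →
    (1 - 4 * r * τ) * extCount G (L ∪ M) S ≤ (chain D s #L #M)⁻¹ * extCount G L S := by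
  classical
  induction S using Finset.strongInduction with | _ S ih => ?_
  intro hS hLS M hM hMr hLM
  set T := {T ∈ S | VertexDisjoint M T} with hT
  have hTS : T ⊆ S := filter_subset _ _
  have hsmall := hS.small
  have hchain : 0 < chain D s #L #M := chain_pos hS.choices_pos hLr hMr
  have hneg := hG.chain_mul_extCount_le (S := T) hL hM hLM (fun T hT => (mem_filter.1 hT).2)
    (fun l hl => (hS.choices_pos l (by omega)).le)
  have hmono := extCount_anti (G := G) (L ∪ M) hTS
  have hdel : (1 - 4 * r * τ) * extCount G L T ≤ extCount G L S := by
    rcases eq_or_ne T S with hTS' | hTS'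
    · rw [hTS']
      have := mul_nonneg (mul_nonneg (Nat.cast_nonneg (α := ℝ) r) hS.nonneg)
        (extCount_nonneg (G := G) L S)
      linarith
    · have hsd : S \ T = {T ∈ S | ¬ VertexDisjoint M T} := by
        rw [hT, ← filter_not]
      have := extCount_sdiff_le (G := G) (D := D) (s := s) (L := L) (S := S) (T := T)
        (β := 2 * r * τ) ?_ ?_
      · linarith
      · intro M' hM'
        have hM'S : M' ∈ S := (Finset.mem_sdiff.1 hM').1
        have hM'r := hS.card_le M' hM'S
        have h1 := ih T (hTS.ssubset_of_ne hTS') (hS.subset hTS) (fun T' hT' => hLS T' (hTS hT'))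
          M' (hS.isMatching M' hM'S) hM'r (hLS M' hM'S)
        have h2 := extCount_nonneg (G := G) (L ∪ M') T
        nlinarith
      · rw [hsd]
        refine (sum_touching_le (fun T hT => ?_) hS.nonneg (hS.sum_le #L hLr) M).trans ?_
        · exact inv_nonneg.2 (chain_pos hS.choices_pos hLr (hS.card_le T hT)).le
        · have := hS.nonneg
          gcongr
  have hle : extCount G (L ∪ M) S ≤ (chain D s #L #M)⁻¹ * extCount G L T := by
    rw [← div_eq_inv_mul, le_div_iff₀ hchain]
    nlinarith
  calc (1 - 4 * r * τ) * extCount G (L ∪ M) S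
      ≤ (1 - 4 * r * τ) * ((chain D s #L #M)⁻¹ * extCount G L T) := by
        gcongr
        linarith
    _ = (chain D s #L #M)⁻¹ * ((1 - 4 * r * τ) * extCount G L T) := by ring
    _ ≤ _ := by gcongr

lemma IsThin.extCount_union_le_two_mul {D s r : ℕ} {τ : ℝ} (hG : IsSwapRegular G D s)
    {L : Finset (Sym2 V)} (hL : IsMatching G L) (hLr : #L ≤ r) {S : Finset (Finset (Sym2 V))}
    (hS : IsThin G D s r τ S) (hLS : ∀ T ∈ S, VertexDisjoint L T) {M : Finset (Sym2 V)}
    (hM : IsMatching G M) (hMr : #M ≤ r) (hLM : VertexDisjoint L M) :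
    extCount G (L ∪ M) S ≤ 2 * (chain D s #L #M)⁻¹ * extCount G L S := by
  have h1 := IsThin.extCount_union_le hG hL hLr S hS hLS M hM hMr hLM
  have h2 := extCount_nonneg (G := G) (L ∪ M) S
  have h3 := hS.small
  nlinarith

/-! ### Near-positive dependence -/

/-- Positive dependence up to a factor, one edge at a time. Exchanging `v` and `w` maps the
matchings through `uw` that avoid `S` to matchings through `uv` that avoid the members of `S` not
covering `w`; the local lemma shows that few of these contain a member of `S` covering `w`. -/
lemma IsThin.extCount_le_choices_mul {D s r : ℕ} {τ : ℝ} (hG : IsSwapRegular G D s)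
    {L : Finset (Sym2 V)} {S : Finset (Finset (Sym2 V))} (hS : IsThin G D s r τ S) {u v : V}
    (hL : IsMatching G L) (hLr : #L + 1 ≤ r) (hu : ¬ Covers L u) (hv : v ∈ free G L u)
    (hLS : ∀ T ∈ S, VertexDisjoint (insert s(u, v) L) T) :
    (1 - 2 * τ) * extCount G L S ≤ choices D s #L * extCount G (insert s(u, v) L) S := by
  classical
  have hv' := mem_free.1 hv
  have hL' := hL.insert hv'.1 hu hv'.2
  have hcard : #(insert s(u, v) L) ≤ r := (card_insert_le _ _).trans hLr
  have hcov : ∀ x ∈ s(u, v), Covers (insert s(u, v) L) x := fun x hx => ⟨_, by simp, hx⟩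
  have hr1 : (1 : ℝ) ≤ r := by exact_mod_cast (show 1 ≤ r by omega)
  have hτ := hS.nonneg
  have hsmall := hS.small
  rw [extCount_eq_sum S hu, ← hG.card_free_real hL hu, mul_sum, ← nsmul_eq_mul]
  refine sum_le_card_nsmul _ _ _ fun w hw => ?_
  set T := {T ∈ S | ¬ Covers T w} with hT
  have hTS : T ⊆ S := filter_subset _ _
  have hsd : S \ T = {T ∈ S | Covers T w} := by
    ext M
    simp only [hT, Finset.mem_sdiff, mem_filter]
    tauto
  have h1 : extCount G (insert s(u, w) L) S ≤ extCount G (insert s(u, v) L) T :=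
    (extCount_anti _ hTS).trans (hG.extCount_insert_le hw hv
      (fun M hM => hLS M (hTS hM) u (hcov u (by simp))) (fun M hM => (mem_filter.1 hM).2))
  have h2 : (1 - 2 * τ) * extCount G (insert s(u, v) L) T ≤ extCount G (insert s(u, v) L) S := by
    refine extCount_sdiff_le (D := D) (s := s) ?_ ?_
    · intro M hM
      have hMS := (Finset.mem_sdiff.1 hM).1
      exact IsThin.extCount_union_le_two_mul hG hL' hcard (hS.subset hTS)
        (fun T' hT' => hLS T' (hTS hT')) (hS.isMatching M hMS) (hS.card_le M hMS) (hLS M hMS)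
    · rw [hsd]
      exact hS.sum_le _ hcard w
  refine le_trans (mul_le_mul_of_nonneg_left h1 ?_) h2
  nlinarith

/-- Prescribing a matching `M` that is vertex-disjoint from all members of `S` hardly makes it
harder to avoid `S`. -/
lemma IsThin.extCount_le_chain_mul {D s r : ℕ} {τ : ℝ} (hG : IsSwapRegular G D s)
    {S : Finset (Finset (Sym2 V))} (hS : IsThin G D s r τ S) {M : Finset (Sym2 V)}
    (hM : IsMatching G M) (hMr : #M ≤ r) (hMS : ∀ T ∈ S, VertexDisjoint M T) :
    (1 - 2 * τ) ^ #M * extCount G ∅ S ≤ chain D s 0 #M * extCount G M S := by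
  induction M using Finset.induction_on with
  | empty => simp [chain]
  | @insert e M he ih =>
    have hM' : IsMatching G M := hM.subset (subset_insert _ _)
    have hcard := card_insert_of_notMem he
    rw [hcard] at hMr ⊢
    have ih' := ih hM' (by omega) (fun T hT x hx => hMS T hT x (hx.mono (subset_insert _ _)))
    induction e using Sym2.ind with | _ a b => ?_
    have hab : G.Adj a b := hM.1 s(a, b) (by simp)
    have step := hS.extCount_le_choices_mul hG hM' hMr (hM.not_covers he (v := a) (by simp))
      (mem_free.2 ⟨hab, hM.not_covers he (v := b) (by simp)⟩) hMS
    have hr1 : (1 : ℝ) ≤ r := by exact_mod_cast (show 1 ≤ r by omega)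
    have hτ := hS.nonneg
    have hsmall := hS.small
    have hc := (chain_pos (j := #M) hS.choices_pos (Nat.zero_le r) (by omega)).le
    rw [chain, prod_range_succ, ← chain, zero_add, pow_succ]
    calc _ = (1 - 2 * τ) * ((1 - 2 * τ) ^ #M * extCount G ∅ S) := by ring
      _ ≤ (1 - 2 * τ) * (chain D s 0 #M * extCount G M S) := by
          gcongr
          nlinarith
      _ = chain D s 0 #M * ((1 - 2 * τ) * extCount G M S) := by ring
      _ ≤ chain D s 0 #M * (choices D s #M * extCount G (insert s(a, b) M) S) := by gcongr
      _ = _ := by ring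

/-! ### Probabilities of canonical events -/

lemma vertexDisjoint_empty (M : Finset (Sym2 V)) : VertexDisjoint ∅ M :=
  fun _ h => (not_covers_empty h).elim

lemma prob_subset_eq_div (M : Finset (Sym2 V)) :
    prob G (fun F => M ⊆ F) = extCount G M ∅ / extCount G ∅ ∅ := by
  simp [prob, extCount]

lemma probNone_eq_div (𝓜 : Finset (Finset (Sym2 V))) :
    probNone G 𝓜 = extCount G ∅ 𝓜 / extCount G ∅ ∅ := by
  simp [probNone, prob, extCount]

lemma extCount_empty_pos (h : (perfectMatchings G).Nonempty) : 0 < extCount G ∅ ∅ := by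
  simpa [extCount] using h

/-- A matching `M` is contained in a random perfect matching with probability
`1 / ∏ l < #M, (D - s * l)`. -/
lemma IsSwapRegular.prob_subset_eq {D s r : ℕ} (hG : IsSwapRegular G D s)
    (hne : (perfectMatchings G).Nonempty) (hpos : ∀ l < 2 * r, 0 < choices D s l)
    {M : Finset (Sym2 V)} (hM : IsMatching G M) (hMr : #M ≤ r) :
    prob G (fun F => M ⊆ F) = (chain D s 0 #M)⁻¹ := by
  have hthin : IsThin G D s r 0 (∅ : Finset (Finset (Sym2 V))) :=
    ⟨by simp, by simp, hpos, le_rfl, by simp, by simp⟩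
  have h1 := hthin.extCount_le_chain_mul hG hM hMr (by simp)
  have h2 := hG.chain_mul_extCount_le (S := ∅) isMatching_empty hM (vertexDisjoint_empty M)
    (by simp) (fun l hl => (hpos l (by rw [card_empty] at hl; omega)).le)
  have hc := chain_pos (j := #M) hpos (Nat.zero_le r) hMr
  have h0 := extCount_empty_pos hne
  rw [card_empty, empty_union] at h2
  rw [mul_zero, sub_zero, one_pow, one_mul] at h1
  rw [prob_subset_eq_div, div_eq_iff h0.ne', ← div_eq_inv_mul, eq_div_iff hc.ne', mul_comm]
  exact le_antisymm h2 h1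

/-- When `N ≥ 16 * r ^ 2`, partners never run out during the first `2 * r` choices, and removing a
matching of size at most `r` at most doubles the probability of containing a given matching of
size at most `r`. -/
lemma inv_chain_le_two_mul {D s r N k j : ℕ} (hs : s ≤ 2) (hD : N ≤ D + 1) (hr : 1 ≤ r)
    (hN : 16 * r ^ 2 ≤ N) (hk : k ≤ r) (hj : j ≤ r) :
    (∀ l < 2 * r, 0 < choices D s l) ∧ (chain D s k j)⁻¹ ≤ 2 * (chain D s 0 j)⁻¹ := by
  have hr' : (1 : ℝ) ≤ r := by exact_mod_cast hr
  have hN' : 16 * (r : ℝ) ^ 2 ≤ N := by exact_mod_cast hN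
  have hD' : (N : ℝ) ≤ D + 1 := by exact_mod_cast hD
  have hs' : (s : ℝ) ≤ 2 := by exact_mod_cast hs
  have hNpos : (0 : ℝ) < N := by nlinarith
  have hbig : ∀ l < 2 * r, (N : ℝ) / 2 ≤ choices D s l := by
    intro l hl
    have hl' : (l : ℝ) + 1 ≤ 2 * r := by exact_mod_cast hl
    have : (s : ℝ) * l ≤ 2 * l := by gcongr
    unfold choices
    nlinarith
  have hpos : ∀ l < 2 * r, 0 < choices D s l := fun l hl => (half_pos hNpos).trans_le (hbig l hl)
  refine ⟨hpos, ?_⟩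
  have hk0 := chain_pos hpos hk hj
  have h00 := chain_pos hpos (Nat.zero_le r) hj
  have hx : 4 * (r : ℝ) / N ≤ 1 := by
    rw [div_le_one hNpos]
    nlinarith
  have key : (1 - 4 * (r : ℝ) / N) ^ j * chain D s 0 j ≤ chain D s k j := by
    have : (1 - 4 * (r : ℝ) / N) ^ j * chain D s 0 j
        = ∏ l ∈ range j, (1 - 4 * (r : ℝ) / N) * choices D s (0 + l) := by
      rw [prod_mul_distrib, prod_const, card_range, chain]
    rw [this, chain]
    refine prod_le_prod (fun l hl => ?_) (fun l hl => ?_)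
    · have := mem_range.1 hl
      exact mul_nonneg (by linarith) (hpos _ (by omega)).le
    · have hlr := mem_range.1 hl
      have hb := hbig l (by omega)
      have hk' : (k : ℝ) ≤ r := by exact_mod_cast hk
      have h1 : (s : ℝ) * k ≤ 2 * r := by gcongr
      have h2 : 4 * (r : ℝ) / N * (N / 2) ≤ 4 * (r : ℝ) / N * choices D s l := by gcongr
      have h3 : 4 * (r : ℝ) / N * (N / 2) = 2 * r := by field_simp; ring
      have h4 : choices D s (k + l) = choices D s l - s * k := by
        simp only [choices]; push_cast; ring
      rw [h4, zero_add]
      linarith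
  have hbern : (1 : ℝ) / 2 ≤ (1 - 4 * (r : ℝ) / N) ^ j := by
    have h1 := one_add_mul_le_pow (a := -(4 * (r : ℝ) / N)) (by linarith) j
    have hj' : (j : ℝ) ≤ r := by exact_mod_cast hj
    have h2 : (j : ℝ) * (4 * r / N) ≤ 1 / 4 := by
      calc (j : ℝ) * (4 * r / N) ≤ r * (4 * r / N) := by gcongr
        _ = 4 * r ^ 2 / N := by ring
        _ ≤ 1 / 4 := by rw [div_le_iff₀ hNpos]; linarith
    rw [← sub_eq_add_neg] at h1
    linarith
  rw [inv_le_comm₀ hk0 (by positivity), mul_inv, inv_inv]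
  nlinarith

/-! ### Consequences of regularity -/

open Classical in
/-- Double counting: in a regular collection the weights of the members at each vertex are an
average, hence at most `2 * r / N` times the total weight. -/
lemma IsRegular.sum_covers_le {𝓜 : Finset (Finset (Sym2 V))} (hreg : IsRegular 𝓜) {r N : ℕ}
    (hr : ∀ M ∈ 𝓜, #M ≤ r) (hN : 0 < N) (hV : N ≤ Fintype.card V) {f : ℕ → ℝ}
    (hf : ∀ M ∈ 𝓜, 0 ≤ f #M) (v : V) :
    ∑ M ∈ 𝓜 with Covers M v, f #M ≤ 2 * r * (∑ M ∈ 𝓜, f #M) / N := by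
  have hval : ∀ w : V, ∑ M ∈ 𝓜 with Covers M w, f #M
      = ∑ j ∈ 𝓜.image card, (degree 𝓜 j w : ℝ) * f j := by
    intro w
    rw [← sum_fiberwise_of_maps_to (s := 𝓜.filter fun M => Covers M w) (t := 𝓜.image card)
      (g := card) (fun M hM => mem_image_of_mem _ (mem_filter.1 hM).1)]
    refine sum_congr rfl fun j _ => ?_
    rw [filter_filter, sum_congr rfl (g := fun _ => f j)
      (fun M hM => by rw [(mem_filter.1 hM).2.2]), sum_const, nsmul_eq_mul]
    congr 2
    unfold degree
    congr 1
    ext M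
    simp only [mem_filter]
    tauto
  have hconst : ∀ w : V, ∑ M ∈ 𝓜 with Covers M w, f #M = ∑ M ∈ 𝓜 with Covers M v, f #M := by
    intro w
    rw [hval, hval]
    refine sum_congr rfl fun j _ => ?_
    obtain ⟨d, hd⟩ := hreg j
    rw [hd, hd]
  have hnn : 0 ≤ ∑ M ∈ 𝓜 with Covers M v, f #M :=
    sum_nonneg fun M hM => hf M (mem_filter.1 hM).1
  rw [le_div_iff₀ (by exact_mod_cast hN)]
  calc (∑ M ∈ 𝓜 with Covers M v, f #M) * N
      ≤ (∑ M ∈ 𝓜 with Covers M v, f #M) * Fintype.card V := by gcongr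
    _ = ∑ w : V, ∑ M ∈ 𝓜 with Covers M w, f #M := by
        rw [sum_congr rfl fun w _ => hconst w, sum_const, nsmul_eq_mul, card_univ, mul_comm]
    _ = ∑ M ∈ 𝓜, #(support M) * f #M := by
        simp only [sum_filter]
        rw [sum_comm]
        refine sum_congr rfl fun M _ => ?_
        rw [← sum_filter, sum_const, nsmul_eq_mul]
        congr 3
        ext w
        simp [mem_support]
    _ ≤ ∑ M ∈ 𝓜, 2 * r * f #M := by
        refine sum_le_sum fun M hM => ?_
        have h1 : (#(support M) : ℝ) ≤ 2 * #M := by exact_mod_cast card_support_le M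
        have h2 : (#M : ℝ) ≤ r := by exact_mod_cast hr M hM
        exact mul_le_mul_of_nonneg_right (by linarith) (hf M hM)
    _ = _ := by rw [mul_sum]

/-! ### Two-sided bounds for the probability of avoiding the collection -/

/-- The local lemma bound, accumulated over the members of the collection. -/
lemma IsThin.exp_mul_le_extCount {D s r : ℕ} {τ : ℝ} (hG : IsSwapRegular G D s)
    {S : Finset (Finset (Sym2 V))} (hS : IsThin G D s r τ S) (hr : 1 ≤ r)
    (hsmall : 16 * r * τ ≤ 1) (hne : ∀ M ∈ S, M.Nonempty) :
    Real.exp (-((1 + 16 * r * τ) * ∑ M ∈ S, (chain D s 0 #M)⁻¹)) * extCount G ∅ ∅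
      ≤ extCount G ∅ S := by
  classical
  induction S using Finset.induction_on with
  | empty => simp
  | @insert M S hMS ih =>
    have hsub := subset_insert M S
    have hS' := hS.subset hsub
    have ih' := ih hS' (fun M' hM' => hne M' (hsub hM'))
    have hM := hS.isMatching M (mem_insert_self _ _)
    have hMr := hS.card_le M (mem_insert_self _ _)
    have hthin := IsThin.extCount_union_le hG isMatching_empty (by simp) S hS'
      (fun T _ => vertexDisjoint_empty T) M hM hMr (vertexDisjoint_empty M)
    rw [empty_union, card_empty] at hthin
    set p := (chain D s 0 #M)⁻¹ with hp
    have hp0 : 0 < p := inv_pos.2 (chain_pos hS.choices_pos (Nat.zero_le r) hMr)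
    -- The weight of `M` is one of the weights at any vertex that `M` covers.
    have hpτ : p ≤ τ := by
      obtain ⟨e, he⟩ := hne M (mem_insert_self _ _)
      induction e using Sym2.ind with | _ a b => ?_
      refine le_trans ?_ (hS.sum_le 0 (Nat.zero_le r) a)
      refine single_le_sum (f := fun M : Finset (Sym2 V) => (chain D s 0 #M)⁻¹) ?_
        (mem_filter.2 ⟨mem_insert_self _ _, s(a, b), he, by simp⟩)
      intro T hT
      exact (inv_pos.2 (chain_pos hS.choices_pos (Nat.zero_le r)
        (hS.card_le T (mem_filter.1 hT).1))).le
    have hr' : (1 : ℝ) ≤ r := by exact_mod_cast hr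
    have hτ := hS.nonneg
    obtain ⟨a, ha⟩ : ∃ a : ℝ, a = 4 * r * τ := ⟨_, rfl⟩
    have ha4 : a ≤ 1 / 4 := by rw [ha]; linarith
    have hpa : p ≤ a := by rw [ha]; nlinarith
    have hthin' : (1 - a) * extCount G M S ≤ p * extCount G ∅ S := by rwa [ha]
    have h16 : 1 + 16 * r * τ = 1 + 4 * a := by rw [ha]; ring
    rw [h16] at ih' ⊢
    have hn := extCount_nonneg (G := G) ∅ S
    have hstep : Real.exp (-((1 + 4 * a) * p)) * extCount G ∅ S
        ≤ extCount G ∅ S - extCount G M S := by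
      have ht0 : 0 ≤ (1 + 4 * a) * p := mul_nonneg (by linarith) hp0.le
      have he := Real.add_one_le_exp ((1 + 4 * a) * p)
      have h1 : Real.exp (-((1 + 4 * a) * p)) ≤ ((1 + 4 * a) * p + 1)⁻¹ := by
        rw [Real.exp_neg]
        gcongr
      have h2 : ((1 + 4 * a) * p + 1)⁻¹ ≤ (1 - a - p) / (1 - a) := by
        rw [inv_le_iff_one_le_mul₀ (by linarith), div_mul_eq_mul_div, le_div_iff₀ (by linarith)]
        have h3 : (0 : ℝ) ≤ a * (1 - 4 * a) := mul_nonneg (by linarith) (by linarith)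
        have h4 : (0 : ℝ) ≤ (1 + 4 * a) * p * (a - p) := mul_nonneg ht0 (by linarith)
        nlinarith
      have h5 : (1 - a - p) / (1 - a) * extCount G ∅ S ≤ extCount G ∅ S - extCount G M S := by
        rw [div_mul_eq_mul_div, div_le_iff₀ (by linarith)]
        linarith
      exact (mul_le_mul_of_nonneg_right (h1.trans h2) hn).trans h5
    rw [extCount_empty_insert, sum_insert hMS, ← hp]
    refine le_trans ?_ hstep
    rw [mul_add, neg_add, Real.exp_add, mul_assoc]
    gcongr

/-- Near-positive dependence of `M` on any family of other members of the collection. Members in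
conflict with `M` play no role; those sharing an edge with `M` leave a residual matching, and
prescribing the residual matchings costs at most `4 * δ`. -/
lemma IsThin.mul_extCount_le {D s r : ℕ} {τ δ : ℝ} (hG : IsSwapRegular G D s)
    {𝓜 S : Finset (Finset (Sym2 V))} (h𝓜 : IsThin G D s r τ 𝓜)
    (hw : ∀ k ≤ r, ∀ j ≤ r, (chain D s k j)⁻¹ ≤ 2 * (chain D s 0 j)⁻¹) {M : Finset (Sym2 V)}
    (hM : M ∈ 𝓜) (hS : S ⊆ 𝓜) (hMS : M ∉ S)
    (hres : ∑ R ∈ residual G 𝓜 M, (chain D s 0 #R)⁻¹ ≤ δ) (hδ : 4 * δ ≤ 1) :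
    (1 - (4 * δ + 2 * r * τ)) * ((chain D s 0 #M)⁻¹ * extCount G ∅ S) ≤ extCount G M S := by
  classical
  have hMm := h𝓜.isMatching M hM
  have hMr := h𝓜.card_le M hM
  have hτ := h𝓜.nonneg
  have hsm := h𝓜.small
  set T := {T ∈ S | VertexDisjoint M T} with hT
  have hTS : T ⊆ S := filter_subset _ _
  have hTthin := h𝓜.subset (hTS.trans hS)
  have hMT : ∀ T' ∈ T, VertexDisjoint M T' := fun T' hT' => (mem_filter.1 hT').2
  have hunion : extCount G M T ≤
      extCount G M S + ∑ R ∈ residual G 𝓜 M, extCount G (M ∪ R) T := by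
    refine extCount_le_add_sum M S T _ fun F hF hMF M' hM' hM'T hM'F => ?_
    refine ⟨M' \ M, mem_image.2 ⟨M', mem_filter.2 ⟨hS hM', ?_, ?_, ?_⟩, rfl⟩,
      sdiff_subset.trans hM'F⟩
    · rintro rfl
      exact hMS hM'
    · have : ¬ VertexDisjoint M M' := fun h => hM'T (mem_filter.2 ⟨hM', h⟩)
      unfold VertexDisjoint at this
      push Not at this
      obtain ⟨v, ⟨e, he, hve⟩, f, hf, hvf⟩ := this
      have hef := (mem_perfectMatchings.1 hF).1.2 e (hMF he) f (hM'F hf) v hve hvf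
      exact ⟨e, mem_inter.2 ⟨hef ▸ hf, he⟩⟩
    · exact not_not.2 ((mem_perfectMatchings.1 hF).1.subset (union_subset hMF hM'F))
  have hn := extCount_nonneg (G := G) M T
  have hsum : ∑ R ∈ residual G 𝓜 M, extCount G (M ∪ R) T ≤ 4 * δ * extCount G M T := by
    calc ∑ R ∈ residual G 𝓜 M, extCount G (M ∪ R) T
        ≤ ∑ R ∈ residual G 𝓜 M, 4 * (chain D s 0 #R)⁻¹ * extCount G M T := by
          refine sum_le_sum fun R hR => ?_
          obtain ⟨M', hM', rfl⟩ := mem_image.1 hR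
          obtain ⟨hM', -, -, hconf⟩ := mem_filter.1 hM'
          have hcomp : IsMatching G (M ∪ M') := not_not.1 hconf
          have hRr : #(M' \ M) ≤ r := (card_le_card sdiff_subset).trans (h𝓜.card_le M' hM')
          have hdis : VertexDisjoint M (M' \ M) := by
            rintro v ⟨e, he, hve⟩ ⟨f, hf, hvf⟩
            obtain ⟨hf, hfM⟩ := Finset.mem_sdiff.1 hf
            have := hcomp.2 e (mem_union_left _ he) f (mem_union_right _ hf) v hve hvf
            exact hfM (this ▸ he)
          have h1 := IsThin.extCount_union_le_two_mul hG hMm hMr hTthin hMT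
            ((h𝓜.isMatching M' hM').subset sdiff_subset) hRr hdis
          have h2 := mul_le_mul_of_nonneg_right (hw #M hMr _ hRr) hn
          linarith
      _ = 4 * (∑ R ∈ residual G 𝓜 M, (chain D s 0 #R)⁻¹) * extCount G M T := by
          rw [mul_sum, sum_mul]
      _ ≤ _ := by gcongr
  have hpos := hTthin.extCount_le_chain_mul hG hMm hMr hMT
  have hc : 0 < chain D s 0 #M := chain_pos h𝓜.choices_pos (Nat.zero_le r) hMr
  have hbern : 1 - 2 * r * τ ≤ (1 - 2 * τ) ^ #M := by
    rcases Nat.eq_zero_or_pos r with hr | hr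
    · have h0 : #M = 0 := by omega
      rw [h0, hr]
      simp
    · have hr' : (1 : ℝ) ≤ r := by exact_mod_cast hr
      have hMr' : (#M : ℝ) ≤ r := by exact_mod_cast hMr
      have h1 := one_add_mul_le_pow (a := -(2 * τ)) (by nlinarith) #M
      rw [← sub_eq_add_neg] at h1
      nlinarith
  have hTle := extCount_anti (G := G) ∅ hTS
  have h0S := extCount_nonneg (G := G) ∅ S
  have hrτ : 0 ≤ (r : ℝ) * τ := by positivity
  have hδ0 : 0 ≤ δ := by
    refine le_trans (sum_nonneg fun R hR => ?_) hres
    obtain ⟨M', hM', rfl⟩ := mem_image.1 hR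
    have hRr : #(M' \ M) ≤ r :=
      (card_le_card sdiff_subset).trans (h𝓜.card_le M' (mem_filter.1 hM').1)
    exact (inv_pos.2 (chain_pos h𝓜.choices_pos (Nat.zero_le r) hRr)).le
  have hA : (1 - 2 * r * τ) * ((chain D s 0 #M)⁻¹ * extCount G ∅ S) ≤ extCount G M T := by
    rw [← div_eq_inv_mul, ← mul_div_assoc, div_le_iff₀ hc, mul_comm (extCount G M T)]
    refine le_trans (mul_le_mul hbern hTle h0S ?_) hpos
    exact le_trans (by linarith) hbern
  have hq : 0 ≤ (chain D s 0 #M)⁻¹ * extCount G ∅ S := by positivity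
  calc (1 - (4 * δ + 2 * r * τ)) * ((chain D s 0 #M)⁻¹ * extCount G ∅ S)
      ≤ (1 - 4 * δ) * ((1 - 2 * r * τ) * ((chain D s 0 #M)⁻¹ * extCount G ∅ S)) := by
        rw [← mul_assoc (1 - 4 * δ)]
        refine mul_le_mul_of_nonneg_right ?_ hq
        nlinarith
    _ ≤ (1 - 4 * δ) * extCount G M T := mul_le_mul_of_nonneg_left hA (by linarith)
    _ ≤ _ := by linarith

/-- The near-positive dependence bound, accumulated over the members of the collection. -/
lemma IsThin.extCount_le_exp_mul {D s r : ℕ} {τ δ : ℝ} (hG : IsSwapRegular G D s)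
    {𝓜 : Finset (Finset (Sym2 V))} (h𝓜 : IsThin G D s r τ 𝓜)
    (hw : ∀ k ≤ r, ∀ j ≤ r, (chain D s k j)⁻¹ ≤ 2 * (chain D s 0 j)⁻¹)
    (hres : ∀ M ∈ 𝓜, ∑ R ∈ residual G 𝓜 M, (chain D s 0 #R)⁻¹ ≤ δ) (hδ : 4 * δ ≤ 1)
    {S : Finset (Finset (Sym2 V))} (hS : S ⊆ 𝓜) :
    extCount G ∅ S ≤
      Real.exp (-((1 - (4 * δ + 2 * r * τ)) * ∑ M ∈ S, (chain D s 0 #M)⁻¹)) * extCount G ∅ ∅ := by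
  induction S using Finset.induction_on with
  | empty => simp
  | @insert M S hMS ih =>
    have hS' := (subset_insert M S).trans hS
    have hM := hS (mem_insert_self M S)
    have hstep := h𝓜.mul_extCount_le hG hw hM hS' hMS (hres M hM) hδ
    rw [extCount_empty_insert, sum_insert hMS]
    set q := (1 - (4 * δ + 2 * r * τ)) * (chain D s 0 #M)⁻¹ with hq
    have he := Real.add_one_le_exp (-q)
    have hn := extCount_nonneg (G := G) ∅ S
    calc extCount G ∅ S - extCount G M S ≤ (-q + 1) * extCount G ∅ S := by
          rw [hq]; linarith
      _ ≤ Real.exp (-q) * extCount G ∅ S := by gcongr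
      _ ≤ Real.exp (-q) * _ := mul_le_mul_of_nonneg_left (ih hS') (Real.exp_pos _).le
      _ = _ := by rw [mul_add, neg_add, Real.exp_add, mul_assoc (Real.exp _)]

/-- Explicit bounds for the probability that no member of a regular collection occurs. -/
theorem IsSwapRegular.probNone_bounds {D s N : ℕ} {δ : ℝ} (hG : IsSwapRegular G D s) (hs : s ≤ 2)
    (hD : N ≤ D + 1) (hV : N ≤ Fintype.card V) (hne : (perfectMatchings G).Nonempty)
    {𝓜 : Finset (Finset (Sym2 V))} (hcoll : IsCollection G 𝓜) (hreg : IsRegular 𝓜)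
    (hr : 1 ≤ maxSize 𝓜) (hN : 16 * maxSize 𝓜 ^ 2 ≤ N)
    (hμN : 64 * (maxSize 𝓜 : ℝ) ^ 2 * mu G 𝓜 ≤ N)
    (hres : ∀ M ∈ 𝓜, ∑ R ∈ residual G 𝓜 M, (chain D s 0 #R)⁻¹ ≤ δ) (hδ : 4 * δ ≤ 1) :
    Real.exp (-mu G 𝓜 - 64 * ((maxSize 𝓜 * mu G 𝓜) ^ 2 / N)) ≤ probNone G 𝓜 ∧
      probNone G 𝓜 ≤
        Real.exp (-mu G 𝓜 + (4 * (δ * mu G 𝓜) + 8 * ((maxSize 𝓜 * mu G 𝓜) ^ 2 / N))) := by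
  classical
  set r := maxSize 𝓜 with hr_def
  have hcard : ∀ M ∈ 𝓜, #M ≤ r := fun M hM => le_sup (f := card) hM
  have hw : ∀ k ≤ r, ∀ j ≤ r, (chain D s k j)⁻¹ ≤ 2 * (chain D s 0 j)⁻¹ :=
    fun k hk j hj => (inv_chain_le_two_mul hs hD hr hN hk hj).2
  have hpos := (inv_chain_le_two_mul hs hD hr hN hr hr).1
  have hμ : mu G 𝓜 = ∑ M ∈ 𝓜, (chain D s 0 #M)⁻¹ :=
    sum_congr rfl fun M hM => hG.prob_subset_eq hne hpos (hcoll M hM).1 (hcard M hM)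
  have hnn : ∀ M ∈ 𝓜, 0 ≤ (chain D s 0 #M)⁻¹ := fun M hM =>
    (inv_pos.2 (chain_pos hpos (Nat.zero_le r) (hcard M hM))).le
  have hNpos : 0 < N := by nlinarith
  have hNpos' : (0 : ℝ) < N := by exact_mod_cast hNpos
  have hμ0 : 0 ≤ mu G 𝓜 := by rw [hμ]; exact sum_nonneg hnn
  set τ : ℝ := 4 * r * mu G 𝓜 / N with hτ
  have hsmall : 16 * r * τ ≤ 1 := by
    rw [hτ, ← mul_div_assoc, div_le_one hNpos']
    linarith
  have hτ0 : 0 ≤ τ := by positivity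
  have hthin : IsThin G D s r τ 𝓜 := by
    refine ⟨fun M hM => (hcoll M hM).1, hcard, hpos, hτ0, ?_, fun k hk v => ?_⟩
    · have : 0 ≤ (r : ℝ) * τ := by positivity
      linarith
    · calc ∑ M ∈ 𝓜 with Covers M v, (chain D s k #M)⁻¹
          ≤ ∑ M ∈ 𝓜 with Covers M v, 2 * (chain D s 0 #M)⁻¹ :=
            sum_le_sum fun M hM => hw k hk _ (hcard M (mem_filter.1 hM).1)
        _ = 2 * ∑ M ∈ 𝓜 with Covers M v, (chain D s 0 #M)⁻¹ := by rw [mul_sum]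
        _ ≤ 2 * (2 * r * mu G 𝓜 / N) := by
            rw [hμ]
            exact mul_le_mul_of_nonneg_left (hreg.sum_covers_le hcard hNpos hV
              (f := fun j => (chain D s 0 j)⁻¹) hnn v) (by norm_num)
        _ = τ := by rw [hτ]; ring
  have h0 := extCount_empty_pos hne
  have hlow := hthin.exp_mul_le_extCount hG hr hsmall (fun M hM => (hcoll M hM).2)
  have hup := hthin.extCount_le_exp_mul hG hw hres hδ subset_rfl
  rw [← hμ] at hlow hup
  rw [probNone_eq_div]
  constructor
  · rw [le_div_iff₀ h0]
    refine le_of_eq_of_le ?_ hlow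
    congr 2
    rw [hτ]
    ring
  · rw [div_le_iff₀ h0]
    refine hup.trans_eq ?_
    congr 2
    rw [hτ]
    ring

/-! ### Asymptotics -/

lemma perfectMatchings_nonempty_of_mu_pos {𝓜 : Finset (Finset (Sym2 V))} (h : 0 < mu G 𝓜) :
    (perfectMatchings G).Nonempty := by
  by_contra hne
  rw [not_nonempty_iff_eq_empty] at hne
  simp [mu, prob, hne] at h

lemma one_le_maxSize_of_mu_pos {𝓜 : Finset (Finset (Sym2 V))} (h : 0 < mu G 𝓜)
    (hcoll : IsCollection G 𝓜) : 1 ≤ maxSize 𝓜 := by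
  obtain ⟨M, hM⟩ : 𝓜.Nonempty := by
    rw [nonempty_iff_ne_empty]
    rintro rfl
    simp [mu] at h
  exact (card_pos.2 (hcoll M hM).2).trans_le (le_sup (f := card) hM)

end

/-- The asymptotic formula for any sequence of graphs with the symmetries of `K_N` and
`K_{N,N}`. -/
theorem isEquivalent_probNone {V : ℕ → Type*} [∀ n, Fintype (V n)] [∀ n, DecidableEq (V n)]
    (G : ∀ n, SimpleGraph (V n)) (N D : ℕ → ℕ) {s : ℕ} (p : ℤ → ℕ → ℝ)
    (𝓜 : ∀ n, Finset (Finset (Sym2 (V n)))) (δ : ℕ → ℝ)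
    (hG : ∀ n, IsSwapRegular (G n) (D n) s) (hs : s ≤ 2) (hD : ∀ n, N n ≤ D n + 1)
    (hV : ∀ n, N n ≤ Fintype.card (V n))
    (hp : ∀ n j, 0 < N n → p (N n) j = (chain (D n) s 0 j)⁻¹)
    (hcoll : ∀ n, IsCollection (G n) (𝓜 n)) (hreg : ∀ n, IsRegular (𝓜 n))
    (hμ : (fun n => mu (G n) (𝓜 n)) =o[atTop]
      (fun n => √(N n : ℝ) * (maxSize (𝓜 n) : ℝ) ^ (-(3 / 2) : ℝ)))
    (hc : ∃ c : ℝ, 0 < c ∧ ∀ n, c ≤ mu (G n) (𝓜 n))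
    (hsparse : ∀ n, IsSparse p (G n) (N n) (𝓜 n) (δ n))
    (hδ : δ =o[atTop] (fun n => (mu (G n) (𝓜 n))⁻¹)) :
    (fun n => probNone (G n) (𝓜 n)) ~[atTop] (fun n => Real.exp (-mu (G n) (𝓜 n))) := by
  obtain ⟨c, hc0, hc⟩ := hc
  have hμpos : ∀ n, 0 < mu (G n) (𝓜 n) := fun n => hc0.trans_le (hc n)
  have hr : ∀ n, 1 ≤ maxSize (𝓜 n) := fun n => one_le_maxSize_of_mu_pos (hμpos n) (hcoll n)
  have hr' : ∀ n, (1 : ℝ) ≤ maxSize (𝓜 n) := fun n => by exact_mod_cast hr n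
  -- Since `r ≥ 1`, the assumption on `μ` gives `r * μ = o(√N)`, which is all that is needed.
  have hsq : (fun n => ((maxSize (𝓜 n) : ℝ) * mu (G n) (𝓜 n)) ^ 2) =o[atTop]
      (fun n => (N n : ℝ)) := by
    have h1 := (isBigO_refl (fun n => (maxSize (𝓜 n) : ℝ)) atTop).mul_isLittleO hμ
    have h2 : (fun n => (maxSize (𝓜 n) : ℝ) *
        (√(N n : ℝ) * (maxSize (𝓜 n) : ℝ) ^ (-(3 / 2) : ℝ))) =O[atTop]
        (fun n => √(N n : ℝ)) := by
      refine IsBigO.of_bound 1 (Eventually.of_forall fun n => ?_)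
      have hrn := hr' n
      have hle : (maxSize (𝓜 n) : ℝ) ^ (-(3 / 2) : ℝ) ≤ (maxSize (𝓜 n) : ℝ)⁻¹ := by
        rw [← Real.rpow_neg_one]
        exact Real.rpow_le_rpow_of_exponent_le hrn (by norm_num)
      have hr0 : (0 : ℝ) < maxSize (𝓜 n) := by linarith
      rw [Real.norm_of_nonneg (by positivity), Real.norm_of_nonneg (by positivity), one_mul]
      calc (maxSize (𝓜 n) : ℝ) * (√(N n : ℝ) * (maxSize (𝓜 n) : ℝ) ^ (-(3 / 2) : ℝ))
          ≤ (maxSize (𝓜 n) : ℝ) * (√(N n : ℝ) * (maxSize (𝓜 n) : ℝ)⁻¹) := by gcongr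
        _ = √(N n : ℝ) := by field_simp
    refine ((h1.trans_isBigO h2).pow (n := 2) (by norm_num)).congr_right fun n => ?_
    exact Real.sq_sqrt (Nat.cast_nonneg _)
  have hlim1 := hsq.tendsto_div_nhds_zero
  have hlim2 : Tendsto (fun n => δ n * mu (G n) (𝓜 n)) atTop (nhds 0) := by
    simpa using hδ.tendsto_div_nhds_zero
  have hbounds : ∀ᶠ n in atTop,
      Real.exp (-mu (G n) (𝓜 n) - 64 * ((maxSize (𝓜 n) * mu (G n) (𝓜 n)) ^ 2 / N n))
        ≤ probNone (G n) (𝓜 n) ∧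
      probNone (G n) (𝓜 n) ≤ Real.exp (-mu (G n) (𝓜 n) + (4 * (δ n * mu (G n) (𝓜 n)) +
        8 * ((maxSize (𝓜 n) * mu (G n) (𝓜 n)) ^ 2 / N n))) := by
    filter_upwards [hsq.def (c := min (c ^ 2 / 16) (c / 64)) (by positivity),
      hlim2.eventually_lt_const (show (0 : ℝ) < c / 4 by positivity)] with n h1 h2
    have hrn := hr' n
    have hcn := hc n
    have hμn := hμpos n
    rw [Real.norm_of_nonneg (by positivity), Real.norm_of_nonneg (by positivity), mul_pow] at h1
    have h3 : (maxSize (𝓜 n) : ℝ) ^ 2 * mu (G n) (𝓜 n) ^ 2 ≤ c ^ 2 / 16 * N n :=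
      h1.trans (by gcongr; exact min_le_left _ _)
    have h4 : (maxSize (𝓜 n) : ℝ) ^ 2 * mu (G n) (𝓜 n) ^ 2 ≤ c / 64 * N n :=
      h1.trans (by gcongr; exact min_le_right _ _)
    have hN : 16 * maxSize (𝓜 n) ^ 2 ≤ N n := by
      have h5 : (maxSize (𝓜 n) : ℝ) ^ 2 * c ^ 2 ≤ c ^ 2 / 16 * N n := le_trans (by gcongr) h3
      have h6 : 16 * (maxSize (𝓜 n) : ℝ) ^ 2 ≤ N n := by
        refine le_of_mul_le_mul_left ?_ (show 0 < c ^ 2 by positivity)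
        linarith
      exact_mod_cast h6
    have hN0 : 0 < N n := by
      have := hr n
      nlinarith
    refine (hG n).probNone_bounds hs (hD n) (hV n)
      (perfectMatchings_nonempty_of_mu_pos (hμpos n)) (hcoll n) (hreg n) (hr n) hN ?_ ?_ ?_
    · have h5 : (maxSize (𝓜 n) : ℝ) ^ 2 * mu (G n) (𝓜 n) * c ≤ c / 64 * N n := by
        refine le_trans ?_ h4
        rw [sq (mu _ _), ← mul_assoc]
        gcongr
      refine le_of_mul_le_mul_left ?_ hc0
      linarith
    · intro M hM
      have := (hsparse n).residual_sum M hM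
      simpa only [hp n _ hN0] using this
    · by_contra! h
      nlinarith
  rw [isEquivalent_iff_tendsto_one (Eventually.of_forall fun n => (Real.exp_pos _).ne')]
  have hlo : Tendsto (fun n => Real.exp (-(64 * ((maxSize (𝓜 n) * mu (G n) (𝓜 n)) ^ 2 / N n))))
      atTop (nhds 1) := by
    have := (Real.continuous_exp.tendsto _).comp ((hlim1.const_mul 64).neg)
    simpa [Function.comp_def] using this
  have hhi : Tendsto (fun n => Real.exp (4 * (δ n * mu (G n) (𝓜 n)) +
      8 * ((maxSize (𝓜 n) * mu (G n) (𝓜 n)) ^ 2 / N n))) atTop (nhds 1) := by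
    have := (Real.continuous_exp.tendsto _).comp ((hlim2.const_mul 4).add (hlim1.const_mul 8))
    simpa [Function.comp_def] using this
  refine tendsto_of_tendsto_of_tendsto_of_le_of_le' hlo hhi ?_ ?_
  · filter_upwards [hbounds] with n hn
    rw [Pi.div_apply, le_div_iff₀ (Real.exp_pos _), ← Real.exp_add]
    refine le_of_eq_of_le (congrArg Real.exp ?_) hn.1
    ring
  · filter_upwards [hbounds] with n hn
    rw [Pi.div_apply, div_le_iff₀ (Real.exp_pos _), ← Real.exp_add]
    refine hn.2.trans_eq (congrArg Real.exp ?_)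
    ring

/-! ### Complete and complete bipartite graphs -/

lemma isSwapRegular_K (N : ℕ) : IsSwapRegular (K N) (N - 1) 2 where
  adj_swap u v w x y _ _ h := by
    rw [SimpleGraph.top_adj] at h ⊢
    exact (Equiv.swap v w).injective.ne h
  card_adj u := by
    trans #(univ.erase u)
    · congr 1
      ext v
      simp [eq_comm]
    · rw [card_erase_of_mem (mem_univ u), card_univ, Fintype.card_fin]
  card_adj_pair u a b hab hua hub := by
    rw [← card_pair hab.ne]
    congr 1
    ext x
    simp only [mem_filter, SimpleGraph.top_adj, and_iff_left_iff_imp, mem_insert, mem_singleton]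
    rintro (rfl | rfl) <;> assumption

lemma isSwapRegular_KK (N : ℕ) : IsSwapRegular (KK N) N 1 where
  adj_swap u v w x y huv huw h := by
    rcases u with u | u <;> rcases v with v | v <;> rcases w with w | w <;>
      rcases x with x | x <;> rcases y with y | y <;>
      simp [completeBipartiteGraph] at huv huw h <;>
      simp [completeBipartiteGraph, Equiv.swap_apply_def] <;> split_ifs <;> simp
  card_adj u := by
    rcases u with u | u
    · trans #((univ : Finset (Fin N)).map (.inr : Fin N ↪ Fin N ⊕ Fin N))
      · congr 1
        ext (v | v) <;> simp
      · rw [card_map, card_univ, Fintype.card_fin]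
    · trans #((univ : Finset (Fin N)).map (.inl : Fin N ↪ Fin N ⊕ Fin N))
      · congr 1
        ext (v | v) <;> simp
      · rw [card_map, card_univ, Fintype.card_fin]
  card_adj_pair u a b hab _ _ := by
    rcases u with u | u <;> rcases a with a | a <;> rcases b with b | b <;>
      simp [completeBipartiteGraph] at hab <;>
      simp [filter_insert, filter_singleton]

lemma pComplete_eq {N : ℕ} (hN : 0 < N) (j : ℕ) :
    pComplete N j = (chain (N - 1) 2 0 j)⁻¹ := by
  rw [pComplete, chain, one_div]
  congr 1
  refine prod_congr rfl fun l _ => ?_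
  rw [choices, Nat.cast_sub hN]
  push_cast
  ring

lemma pBipartite_eq (N j : ℕ) : pBipartite N j = (chain N 1 0 j)⁻¹ := by
  simp [pBipartite, chain, choices]

end MatchingSieve

theorem theorem5p1 :
    -- random perfect matchings of the complete graphs
    (∀ (N : ℕ → ℕ) (𝓜 : (n : ℕ) → Finset (Finset (Sym2 (Fin (N n))))) (δ : ℕ → ℝ),
      (∀ n, Even (N n)) →
      (∀ n, MatchingSieve.IsCollection (MatchingSieve.K (N n)) (𝓜 n)) →
      (∀ n, MatchingSieve.IsRegular (𝓜 n)) →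
      (fun n => MatchingSieve.mu (MatchingSieve.K (N n)) (𝓜 n)) =o[atTop]
        (fun n => √(N n : ℝ) * (MatchingSieve.maxSize (𝓜 n) : ℝ) ^ (-(3 / 2) : ℝ)) →
      (∃ c : ℝ, 0 < c ∧ ∀ n, c ≤ MatchingSieve.mu (MatchingSieve.K (N n)) (𝓜 n)) →
      (∀ n, MatchingSieve.IsSparse MatchingSieve.pComplete
        (MatchingSieve.K (N n)) (N n) (𝓜 n) (δ n)) →
      δ =o[atTop] (fun n => (MatchingSieve.mu (MatchingSieve.K (N n)) (𝓜 n))⁻¹) →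
      (fun n => MatchingSieve.probNone (MatchingSieve.K (N n)) (𝓜 n)) ~[atTop]
        (fun n => Real.exp (-MatchingSieve.mu (MatchingSieve.K (N n)) (𝓜 n)))) ∧
    -- random perfect matchings of the balanced complete bipartite graphs
    (∀ (N : ℕ → ℕ) (𝓜 : (n : ℕ) → Finset (Finset (Sym2 (Fin (N n) ⊕ Fin (N n)))))
        (δ : ℕ → ℝ),
      (∀ n, MatchingSieve.IsCollection (MatchingSieve.KK (N n)) (𝓜 n)) →
      (∀ n, MatchingSieve.IsRegular (𝓜 n)) →
      (fun n => MatchingSieve.mu (MatchingSieve.KK (N n)) (𝓜 n)) =o[atTop]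
        (fun n => √(N n : ℝ) * (MatchingSieve.maxSize (𝓜 n) : ℝ) ^ (-(3 / 2) : ℝ)) →
      (∃ c : ℝ, 0 < c ∧ ∀ n, c ≤ MatchingSieve.mu (MatchingSieve.KK (N n)) (𝓜 n)) →
      (∀ n, MatchingSieve.IsSparse MatchingSieve.pBipartite
        (MatchingSieve.KK (N n)) (N n) (𝓜 n) (δ n)) →
      δ =o[atTop] (fun n => (MatchingSieve.mu (MatchingSieve.KK (N n)) (𝓜 n))⁻¹) →
      (fun n => MatchingSieve.probNone (MatchingSieve.KK (N n)) (𝓜 n)) ~[atTop]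
        (fun n => Real.exp (-MatchingSieve.mu (MatchingSieve.KK (N n)) (𝓜 n)))) := by
  refine ⟨fun N 𝓜 δ _ hcoll hreg hμ hc hsparse hδ => ?_, fun N 𝓜 δ hcoll hreg hμ hc hsparse hδ => ?_⟩
  · exact MatchingSieve.isEquivalent_probNone _ N (fun n => N n - 1) MatchingSieve.pComplete 𝓜 δ
      (fun n => MatchingSieve.isSwapRegular_K (N n)) le_rfl (fun n => by omega) (fun n => by simp)
      (fun n j hN => MatchingSieve.pComplete_eq hN j) hcoll hreg hμ hc hsparse hδ
  · exact MatchingSieve.isEquivalent_probNone _ N N MatchingSieve.pBipartite 𝓜 δ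
      (fun n => MatchingSieve.isSwapRegular_KK (N n)) one_le_two (fun n => by omega)
      (fun n => by simp) (fun n j _ => MatchingSieve.pBipartite_eq (N n) j)
      hcoll hreg hμ hc hsparse hδ
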